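/- Let $B\in\mathbb C^{p\times m}$ and $C\in\mathbb C^{n\times m}$ be given matrices, let $M\in\mathbb C^{m\times m}$ and $D\in\mathbb C^{n\times n}$ be given Hermitian matrices, and for a variable matrix $X\in\mathbb C^{n\times p}$ put $$\phi(X)=(XB+C)\,M\,(XB+C)^{*}+D .$$ Let $r(\cdot)$ denote rank, and for a Hermitian matrix $H$ let $i_{+}(H)$ and $i_{-}(H)$ be the numbers of positive and of negative eigenvalues of $H$, counted with multiplicity. Define $$N_1=\begin{bmatrix} D+CMC^{*} & CMB^{*}\\ BMC^{*} & BMB^{*}\end{bmatrix},\qquad N_2=[\,BMB^{*},\ BMC^{*}\,].$$ Then the following maxima and minima over $X\in\mathbb C^{n\times p}$ are attained and are given by $$\max_{X} r[\phi(X)]=\min\{\,n,\ r(N_1)\,\},$$ $$\min_{X} r[\phi(X)]=\max\{\,0,\ \ r(N_1)-2r(N_2),\ \ i_{+}(N_1)-r(N_2),\ \ i_{-}(N_1)-r(N_2)\,\},$$ $$\max_{X} i_{\pm}[\phi(X)]=\min\{\,n,\ i_{\pm}(N_1)\,\},$$ $$\min_{X} i_{\pm}[\phi(X)]=\max\{\,0,\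 i_{\pm}(N_1)-r(N_2)\,\},$$ where the last two lines hold both with all upper signs and with all lower signs. -/

import Mathlib

open scoped Matrix

namespace QuadRankInertia

/-- `i₊(A)`: the number of positive eigenvalues, counted with multiplicity, of a Hermitian matrix. -/
noncomputable def posInertia {ι : Type*} [Fintype ι] [DecidableEq ι]
    (A : Matrix ι ι ℂ) (hA : A.IsHermitian) : ℕ :=
  (Finset.univ.filter fun i => 0 < hA.eigenvalues i).card

/-- `i₋(A)`: the number of negative eigenvalues, counted with multiplicity, of a Hermitian matrix. -/
noncomputable def negInertia {ι : Type*} [Fintype ι] [DecidableEq ι]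
    (A : Matrix ι ι ℂ) (hA : A.IsHermitian) : ℕ :=
  (Finset.univ.filter fun i => hA.eigenvalues i < 0).card

variable {n p m : ℕ}

/-- The quadratic matrix-valued function `φ(X) = (XB + C) M (XB + C)* + D`. -/
def phi (B : Matrix (Fin p) (Fin m) ℂ) (C : Matrix (Fin n) (Fin m) ℂ)
    (M : Matrix (Fin m) (Fin m) ℂ) (D : Matrix (Fin n) (Fin n) ℂ)
    (X : Matrix (Fin n) (Fin p) ℂ) : Matrix (Fin n) (Fin n) ℂ :=
  (X * B + C) * M * (X * B + C)ᴴ + D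

/-- The block matrix `N₁ = [[D + CMC*, CMB*], [BMC*, BMB*]]`. -/
def N₁ (B : Matrix (Fin p) (Fin m) ℂ) (C : Matrix (Fin n) (Fin m) ℂ)
    (M : Matrix (Fin m) (Fin m) ℂ) (D : Matrix (Fin n) (Fin n) ℂ) :
    Matrix (Fin n ⊕ Fin p) (Fin n ⊕ Fin p) ℂ :=
  Matrix.fromBlocks (D + C * M * Cᴴ) (C * M * Bᴴ) (B * M * Cᴴ) (B * M * Bᴴ)

/-- The row block matrix `N₂ = [BMB*, BMC*]`. -/
def N₂ (B : Matrix (Fin p) (Fin m) ℂ) (C : Matrix (Fin n) (Fin m) ℂ)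
    (M : Matrix (Fin m) (Fin m) ℂ) : Matrix (Fin p) (Fin p ⊕ Fin n) ℂ :=
  Matrix.fromCols (B * M * Bᴴ) (B * M * Cᴴ)

theorem phi_isHermitian (B : Matrix (Fin p) (Fin m) ℂ) (C : Matrix (Fin n) (Fin m) ℂ)
    {M : Matrix (Fin m) (Fin m) ℂ} {D : Matrix (Fin n) (Fin n) ℂ}
    (hM : M.IsHermitian) (hD : D.IsHermitian) (X : Matrix (Fin n) (Fin p) ℂ) :
    (phi B C M D X).IsHermitian :=
  (Matrix.isHermitian_mul_mul_conjTranspose _ hM).add hD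

theorem N₁_isHermitian (B : Matrix (Fin p) (Fin m) ℂ) (C : Matrix (Fin n) (Fin m) ℂ)
    {M : Matrix (Fin m) (Fin m) ℂ} {D : Matrix (Fin n) (Fin n) ℂ}
    (hM : M.IsHermitian) (hD : D.IsHermitian) : (N₁ B C M D).IsHermitian := by
  refine Matrix.IsHermitian.fromBlocks (hD.add (Matrix.isHermitian_mul_mul_conjTranspose _ hM)) ?_
    (Matrix.isHermitian_mul_mul_conjTranspose _ hM)
  simp [Matrix.conjTranspose_mul, hM.eq, Matrix.mul_assoc]

end QuadRankInertia

/-! Put A = D + CMC*, G = CMB*, E = BMB*. Then φ(X) = [1 X] N₁ [1 X]* is the form N₁ restricted to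
the graph of X*, of dimension n; hence all the upper bounds. Conversely N₁ is φ(X) padded by zeros
plus a term Z*F + F*Z with rank Z ≤ r(N₂). That term vanishes on ker Z, so i±(N₁) ≤ i±(φ(X)) + r(N₂)
(`posInertia_le_add_rank`).

Maxima are attained because a subspace of dimension at most n lies in a graph after an arbitrarily
small perturbation (`exists_conjTranspose_mul_quad_mul_mem`), while definiteness and invertibility
are open conditions.

Minima are attained by one X for both signs (`exists_quad_inertia_le_sub`). A shift of X gives AG =
0 and GE = 0 (`exists_shift_orthogonal`). The form then splits: G adds rank G to each partial
inertia, and eigenvalues of A can be cancelled against eigenvalues of E of opposite sign. Since rank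
is i₊ + i₋, the minimal rank is the sum of the two minimal inertias. -/

namespace QuadRankInertia

open Matrix
open scoped ComplexOrder

/-! ### Inertia bounds from the spectral theorem -/

section Spectral

variable {ι κ α β : Type*} [Fintype ι] [DecidableEq ι] [Fintype κ] [DecidableEq κ]
  [Fintype α] [Fintype β]

theorem eq_mul_diagonal_mul {A : Matrix ι ι ℂ} (hA : A.IsHermitian) :
    A = (hA.eigenvectorUnitary : Matrix ι ι ℂ) * diagonal (fun i => (hA.eigenvalues i : ℂ)) *
      (hA.eigenvectorUnitary : Matrix ι ι ℂ)ᴴ := by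
  conv_lhs => rw [hA.spectral_theorem]
  rfl

theorem eigenvectorUnitary_conjTranspose_mul {A : Matrix ι ι ℂ} (hA : A.IsHermitian) :
    (hA.eigenvectorUnitary : Matrix ι ι ℂ)ᴴ * (hA.eigenvectorUnitary : Matrix ι ι ℂ) = 1 :=
  Unitary.coe_star_mul_self _

theorem mul_eigenvectorUnitary {A : Matrix ι ι ℂ} (hA : A.IsHermitian) :
    A * (hA.eigenvectorUnitary : Matrix ι ι ℂ) =
      (hA.eigenvectorUnitary : Matrix ι ι ℂ) * diagonal (fun i => (hA.eigenvalues i : ℂ)) := by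
  conv_lhs => enter [1]; rw [eq_mul_diagonal_mul hA]
  rw [Matrix.mul_assoc, eigenvectorUnitary_conjTranspose_mul, Matrix.mul_one]

/-- The eigenvectors of a Hermitian matrix selected by `f`, as columns. -/
noncomputable def eigenCols {A : Matrix ι ι ℂ} (hA : A.IsHermitian) (f : κ → ι) : Matrix ι κ ℂ :=
  (hA.eigenvectorUnitary : Matrix ι ι ℂ).submatrix id f

theorem mul_eigenCols {A : Matrix ι ι ℂ} (hA : A.IsHermitian) (f : κ → ι) :
    A * eigenCols hA f = eigenCols hA f * diagonal (fun i => (hA.eigenvalues (f i) : ℂ)) := by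
  have h := congrArg (fun Z : Matrix ι ι ℂ => Z.submatrix id f) (mul_eigenvectorUnitary hA)
  ext i j
  have := congrFun (congrFun h i) j
  simpa [eigenCols, Matrix.mul_apply, Matrix.diagonal_apply] using this

omit [Fintype κ] in
theorem conjTranspose_eigenCols_mul {A : Matrix ι ι ℂ} (hA : A.IsHermitian) {f : κ → ι}
    (hf : Function.Injective f) : (eigenCols hA f)ᴴ * eigenCols hA f = 1 := by
  ext i j
  have := congrFun (congrFun (eigenvectorUnitary_conjTranspose_mul hA) (f i)) (f j)
  simpa [eigenCols, Matrix.mul_apply, Matrix.one_apply, hf.eq_iff] using this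

theorem conjTranspose_eigenCols_mul_mul {A : Matrix ι ι ℂ} (hA : A.IsHermitian) {f : κ → ι}
    (hf : Function.Injective f) : (eigenCols hA f)ᴴ * A * eigenCols hA f =
      diagonal (fun i => (hA.eigenvalues (f i) : ℂ)) := by
  rw [Matrix.mul_assoc, mul_eigenCols, ← Matrix.mul_assoc, conjTranspose_eigenCols_mul hA hf,
    Matrix.one_mul]

omit [Fintype α] in
theorem rank_add_le (K L : Matrix α β ℂ) : (K + L).rank ≤ K.rank + L.rank := by
  classical
  rw [Matrix.rank, Matrix.rank, Matrix.rank, Matrix.mulVecLin_add]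
  refine le_trans (Submodule.finrank_mono ?_)
    (Submodule.finrank_add_le_finrank_add_finrank K.mulVecLin.range L.mulVecLin.range)
  rintro _ ⟨x, rfl⟩
  exact Submodule.add_mem_sup ⟨x, rfl⟩ ⟨x, rfl⟩

omit [DecidableEq κ] [Fintype α] [Fintype β] in
/-- A positive definite matrix which is nonpositive on the common kernel of `K` and `L` has size at
most `rank K + rank L`. -/
theorem card_le_rank_add_rank_of_posDef {P : Matrix κ κ ℂ} (hP : P.PosDef) (K : Matrix α κ ℂ)
    (L : Matrix β κ ℂ)
    (h : ∀ x, K *ᵥ x = 0 → L *ᵥ x = 0 → (star x ⬝ᵥ P *ᵥ x).re ≤ 0) :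
    Fintype.card κ ≤ K.rank + L.rank := by
  have hinj : Function.Injective (K.mulVecLin.rangeRestrict.prod L.mulVecLin.rangeRestrict) := by
    rw [← LinearMap.ker_eq_bot, LinearMap.ker_eq_bot']
    intro x hx
    by_contra hne
    have h1 : K *ᵥ x = 0 := by simpa using congrArg (fun y => (y.1 : α → ℂ)) hx
    have h2 : L *ᵥ x = 0 := by simpa using congrArg (fun y => (y.2 : β → ℂ)) hx
    have h3 := (Complex.pos_iff.1 (hP.dotProduct_mulVec_pos hne)).1
    linarith [h x h1 h2]
  have := LinearMap.finrank_le_finrank_of_injective hinj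
  simpa [Module.finrank_prod, Matrix.rank] using this

theorem re_star_dotProduct_diagonal_nonpos (d : κ → ℝ) (y : κ → ℂ)
    (h : ∀ i, 0 < d i → y i = 0) :
    (star y ⬝ᵥ diagonal (fun i => (d i : ℂ)) *ᵥ y).re ≤ 0 := by
  rw [dotProduct, Complex.re_sum]
  refine Finset.sum_nonpos fun i _ => ?_
  by_cases hi : 0 < d i
  · simp [h i hi]
  · have : (star y i * (diagonal (fun i => (d i : ℂ)) *ᵥ y) i).re = d i * Complex.normSq (y i) := by
      simp [mulVec_diagonal, Complex.normSq_apply]; ring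
    rw [this]
    exact mul_nonpos_of_nonpos_of_nonneg (not_lt.1 hi) (Complex.normSq_nonneg _)

omit [DecidableEq κ] [Fintype α] in
-- On ker Z the form is ∑ dᵢ|(Wx)ᵢ|², which is nonpositive once the coordinates of Wx with dᵢ > 0
-- vanish. These coordinates impose at most #{dᵢ > 0} conditions. Every upper bound on a positive
-- inertia below comes from this count.
theorem card_le_of_posDef_diagonal {P : Matrix κ κ ℂ} (hP : P.PosDef) (d : ι → ℝ)
    (W : Matrix ι κ ℂ) (Z : Matrix α κ ℂ)
    (h : ∀ x, Z *ᵥ x = 0 →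
      star x ⬝ᵥ P *ᵥ x = star x ⬝ᵥ (Wᴴ * diagonal (fun i => (d i : ℂ)) * W) *ᵥ x) :
    Fintype.card κ ≤ (Finset.univ.filter fun i => 0 < d i).card + Z.rank := by
  have := card_le_rank_add_rank_of_posDef hP
    (W.submatrix (fun i : {i // 0 < d i} => (i : ι)) id) Z (fun x h1 h2 => by
      rw [h x h2, Matrix.mul_assoc, ← mulVec_mulVec, dotProduct_mulVec, ← star_mulVec,
        ← mulVec_mulVec]
      exact re_star_dotProduct_diagonal_nonpos d (W *ᵥ x) fun i hi => congrFun h1 ⟨i, hi⟩)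
  refine this.trans (Nat.add_le_add_right ((rank_le_card_height _).trans ?_) _)
  rw [Fintype.card_subtype]

theorem exists_posDef_of_posInertia {A : Matrix ι ι ℂ} (hA : A.IsHermitian) :
    ((eigenCols hA (fun i : {i // 0 < hA.eigenvalues i} => (i : ι)))ᴴ * A *
      eigenCols hA (fun i : {i // 0 < hA.eigenvalues i} => (i : ι))).PosDef := by
  rw [conjTranspose_eigenCols_mul_mul hA Subtype.val_injective, Matrix.posDef_diagonal_iff]
  exact fun i => by simpa using i.2

theorem card_subtype_eq_posInertia {A : Matrix ι ι ℂ} (hA : A.IsHermitian) :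
    Fintype.card {i // 0 < hA.eigenvalues i} = posInertia A hA := by
  rw [Fintype.card_subtype, posInertia]

omit [DecidableEq κ] in
/-- A subspace on which the form is positive definite has dimension at most the positive inertia. -/
theorem card_le_posInertia {A : Matrix ι ι ℂ} (hA : A.IsHermitian) (T : Matrix ι κ ℂ)
    (hT : (Tᴴ * A * T).PosDef) : Fintype.card κ ≤ posInertia A hA := by
  have := card_le_of_posDef_diagonal hT hA.eigenvalues
    ((hA.eigenvectorUnitary : Matrix ι ι ℂ)ᴴ * T) (0 : Matrix κ κ ℂ) (fun x _ => by
      conv_lhs => rw [eq_mul_diagonal_mul hA]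
      simp only [conjTranspose_mul, conjTranspose_conjTranspose, Matrix.mul_assoc])
  simpa [posInertia] using this

/-- Although Zᴴ F + Fᴴ Z may have rank 2 rank Z, it vanishes as a form on ker Z, so it costs only
rank Z. The count is made on the span of the eigenvectors of N with positive eigenvalue. -/
theorem posInertia_le_add_rank {A : Matrix κ κ ℂ} (hA : A.IsHermitian) {N : Matrix ι ι ℂ}
    (hN : N.IsHermitian) (S : Matrix ι κ ℂ) (Z F : Matrix α ι ℂ)
    (h : N = S * A * Sᴴ + (Zᴴ * F + Fᴴ * Z)) :
    posInertia N hN ≤ posInertia A hA + Z.rank := by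
  set T := eigenCols hN (fun i : {i // 0 < hN.eigenvalues i} => (i : ι)) with hT
  have := card_le_of_posDef_diagonal (exists_posDef_of_posInertia hN) hA.eigenvalues
    ((hA.eigenvectorUnitary : Matrix κ κ ℂ)ᴴ * Sᴴ * T) (Z * T) (fun x hx => by
      rw [← hT]
      have e : Tᴴ * N * T = ((hA.eigenvectorUnitary : Matrix κ κ ℂ)ᴴ * Sᴴ * T)ᴴ *
          diagonal (fun i => (hA.eigenvalues i : ℂ)) *
          ((hA.eigenvectorUnitary : Matrix κ κ ℂ)ᴴ * Sᴴ * T) +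
          ((Z * T)ᴴ * (F * T) + (F * T)ᴴ * (Z * T)) := by
        conv_lhs =>
          enter [1, 2]; rw [h]; enter [1, 1, 2]; rw [eq_mul_diagonal_mul hA]
        simp only [conjTranspose_mul, conjTranspose_conjTranspose, Matrix.mul_assoc,
          Matrix.mul_add, Matrix.add_mul]
      have e1 : star x ⬝ᵥ ((Z * T)ᴴ * (F * T)) *ᵥ x = 0 := by
        rw [← mulVec_mulVec, dotProduct_mulVec, ← star_mulVec, hx]; simp
      have e2 : star x ⬝ᵥ ((F * T)ᴴ * (Z * T)) *ᵥ x = 0 := by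
        rw [← mulVec_mulVec, hx]; simp
      rw [e, add_mulVec, add_mulVec, dotProduct_add, dotProduct_add, e1, e2]; simp)
  rw [card_subtype_eq_posInertia] at this
  exact this.trans (Nat.add_le_add_left (rank_mul_le_left _ _) _)

theorem posInertia_mul_mul_conjTranspose_le {A : Matrix κ κ ℂ} (hA : A.IsHermitian)
    {N : Matrix ι ι ℂ} (hN : N.IsHermitian) (S : Matrix ι κ ℂ) (h : N = S * A * Sᴴ) :
    posInertia N hN ≤ posInertia A hA := by
  simpa using posInertia_le_add_rank hA hN S (0 : Matrix ι ι ℂ) 0 (by simpa using h)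

theorem posInertia_le_card_diagonal {A : Matrix ι ι ℂ} (hA : A.IsHermitian) (d : κ → ℝ)
    (R : Matrix ι κ ℂ) (h : A = R * diagonal (fun i => (d i : ℂ)) * Rᴴ) :
    posInertia A hA ≤ (Finset.univ.filter fun i => 0 < d i).card := by
  have := card_le_of_posDef_diagonal (exists_posDef_of_posInertia hA) d
    (Rᴴ * eigenCols hA (fun i : {i // 0 < hA.eigenvalues i} => (i : ι))) (0 : Matrix ι _ ℂ)
    (fun x _ => by
      conv_lhs => enter [2, 1, 1, 2]; rw [h]
      simp only [conjTranspose_mul, conjTranspose_conjTranspose, Matrix.mul_assoc])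
  rw [card_subtype_eq_posInertia] at this
  simpa using this

/-- Used to transfer statements about i₊ to i₋. The eigenvalue families of A and -A are indexed
independently, so each inequality goes through a variational bound. -/
theorem posInertia_neg {A : Matrix ι ι ℂ} (hA : A.IsHermitian) :
    posInertia (-A) hA.neg = negInertia A hA := by
  apply le_antisymm
  · refine (posInertia_le_card_diagonal hA.neg (fun i => - hA.eigenvalues i)
      (hA.eigenvectorUnitary : Matrix ι ι ℂ) ?_).trans_eq ?_
    · conv_lhs => rw [eq_mul_diagonal_mul hA]
      have : (diagonal fun i => ((-hA.eigenvalues i : ℝ) : ℂ)) =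
          - diagonal fun i => (hA.eigenvalues i : ℂ) := by
        ext i j; by_cases hij : i = j <;> simp [hij]
      rw [this, Matrix.mul_neg, Matrix.neg_mul]
    · simp [negInertia]
  · have := card_le_posInertia hA.neg
      (eigenCols hA (fun i : {i // hA.eigenvalues i < 0} => (i : ι))) (by
        rw [Matrix.mul_neg, Matrix.neg_mul,
          conjTranspose_eigenCols_mul_mul hA Subtype.val_injective, diagonal_neg,
          Matrix.posDef_diagonal_iff]
        intro i
        have := i.2
        simpa [Complex.neg_iff] using this)
    rwa [Fintype.card_subtype] at this

theorem rank_eq_posInertia_add_negInertia {A : Matrix ι ι ℂ} (hA : A.IsHermitian) :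
    A.rank = posInertia A hA + negInertia A hA := by
  rw [hA.rank_eq_card_non_zero_eigs, Fintype.card_subtype, posInertia, negInertia,
    ← Finset.card_union_of_disjoint]
  · congr 1; ext i
    simp [lt_or_lt_iff_ne, ne_comm]
  · rw [Finset.disjoint_filter]
    intro i _ h; exact h.not_gt

end Spectral

/-! ### The quadratic function as a compression of a block matrix, and shifts of the variable -/

section Quad

variable {ν π : Type*} [Fintype ν] [DecidableEq ν] [Fintype π] [DecidableEq π]

/-- The value of the Hermitian form with blocks `A`, `G`, `Gᴴ`, `E` on the graph of `Xᴴ`. -/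
def quad (A : Matrix ν ν ℂ) (G : Matrix ν π ℂ) (E : Matrix π π ℂ) (X : Matrix ν π ℂ) :
    Matrix ν ν ℂ :=
  A + X * Gᴴ + G * Xᴴ + X * E * Xᴴ

variable {A : Matrix ν ν ℂ} {G : Matrix ν π ℂ} {E : Matrix π π ℂ}

omit [Fintype ν] [DecidableEq ν] [DecidableEq π] in
theorem quad_isHermitian (hA : A.IsHermitian) (hE : E.IsHermitian) (X : Matrix ν π ℂ) :
    (quad A G E X).IsHermitian := by
  unfold Matrix.IsHermitian quad
  simp only [conjTranspose_add, conjTranspose_mul, conjTranspose_conjTranspose, hA.eq, hE.eq,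
    Matrix.mul_assoc]
  abel

omit [DecidableEq π] in
theorem quad_eq_mul_mul (A : Matrix ν ν ℂ) (G : Matrix ν π ℂ) (E : Matrix π π ℂ)
    (X : Matrix ν π ℂ) :
    quad A G E X = fromCols (1 : Matrix ν ν ℂ) X * fromBlocks A G Gᴴ E *
        (fromCols (1 : Matrix ν ν ℂ) X)ᴴ := by
  rw [conjTranspose_fromCols_eq_fromRows_conjTranspose, fromCols_mul_fromBlocks,
    fromCols_mul_fromRows, quad]
  simp [Matrix.add_mul]
  abel

omit [Fintype ν] [DecidableEq ν] [DecidableEq π] in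
theorem quad_add (A : Matrix ν ν ℂ) (G : Matrix ν π ℂ) (hE : E.IsHermitian)
    (X Y : Matrix ν π ℂ) :
    quad A G E (X + Y) = quad (quad A G E X) (G + X * E) E Y := by
  simp only [quad, conjTranspose_add, conjTranspose_mul, hE.eq, Matrix.mul_add, Matrix.add_mul,
    Matrix.mul_assoc]
  abel

/-- With `quad_add`: a shift of the variable is a unitriangular congruence of the block matrix, so
it cannot raise either partial inertia. -/
theorem fromBlocks_quad_eq (A : Matrix ν ν ℂ) (G : Matrix ν π ℂ) (hE : E.IsHermitian)
    (X : Matrix ν π ℂ) :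
    fromBlocks (quad A G E X) (G + X * E) (G + X * E)ᴴ E =
      fromBlocks 1 X 0 1 * fromBlocks A G Gᴴ E * (fromBlocks 1 X 0 1)ᴴ := by
  rw [fromBlocks_conjTranspose, fromBlocks_multiply, fromBlocks_multiply]
  simp only [quad, conjTranspose_add, conjTranspose_mul, hE.eq, conjTranspose_one,
    conjTranspose_zero, Matrix.one_mul, Matrix.mul_one, Matrix.zero_mul, Matrix.mul_zero,
    zero_add, Matrix.add_mul]
  congr 1
  abel

/-- The factor `fromCols (-Xᴴ) 1` vanishes on the graph of Xᴴ. The halves share E equally between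
the two adjoint products; the other factor then has rank at most that of [E, Gᴴ]. -/
theorem fromBlocks_eq_add (A : Matrix ν ν ℂ) (G : Matrix ν π ℂ) (hE : E.IsHermitian)
    (X : Matrix ν π ℂ) :
    fromBlocks A G Gᴴ E =
      (fromRows (1 : Matrix ν ν ℂ) (0 : Matrix π ν ℂ)) * quad A G E X * (fromRows (1 : Matrix ν ν ℂ) (0 : Matrix π ν ℂ))ᴴ +
      ((fromCols (Gᴴ + (1 / 2 : ℂ) • (E * Xᴴ)) ((1 / 2 : ℂ) • E))ᴴ * fromCols (-Xᴴ) (1 : Matrix π π ℂ) +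
        (fromCols (-Xᴴ) (1 : Matrix π π ℂ))ᴴ * fromCols (Gᴴ + (1 / 2 : ℂ) • (E * Xᴴ)) ((1 / 2 : ℂ) • E)) := by
  simp only [conjTranspose_fromCols_eq_fromRows_conjTranspose,
    conjTranspose_fromRows_eq_fromCols_conjTranspose]
  rw [fromRows_mul]
  simp only [fromRows_mul_fromCols]
  simp only [fromBlocks_add, quad, conjTranspose_add, conjTranspose_mul, hE.eq, conjTranspose_one,
    conjTranspose_zero, Matrix.one_mul, Matrix.mul_one, Matrix.zero_mul, Matrix.mul_zero,
    zero_add, add_zero, Matrix.add_mul, Matrix.mul_add, conjTranspose_smul, Matrix.mul_neg,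
    Matrix.neg_mul, conjTranspose_conjTranspose, conjTranspose_neg, Matrix.smul_mul,
    Matrix.mul_smul, Matrix.mul_assoc]
  have h2 : star (1 / 2 : ℂ) = 1 / 2 := by simp
  rw [h2]
  congr 1
  · module
  · module
  · module
  · module

theorem rank_fromCols_smul_le (G : Matrix ν π ℂ) (E : Matrix π π ℂ) (X : Matrix ν π ℂ) :
    (fromCols (Gᴴ + (1 / 2 : ℂ) • (E * Xᴴ)) ((1 / 2 : ℂ) • E)).rank ≤ (fromCols E Gᴴ).rank := by
  have : fromCols (Gᴴ + (1 / 2 : ℂ) • (E * Xᴴ)) ((1 / 2 : ℂ) • E) = fromCols E Gᴴ *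
      fromBlocks ((1 / 2 : ℂ) • Xᴴ) ((1 / 2 : ℂ) • (1 : Matrix π π ℂ)) (1 : Matrix ν ν ℂ) (0 : Matrix ν π ℂ) := by
    rw [fromCols_mul_fromBlocks]
    simp [add_comm]
  rw [this]
  exact rank_mul_le_left _ _

theorem posInertia_fromBlocks_le (hA : A.IsHermitian) (hE : E.IsHermitian)
    (hN : (fromBlocks A G Gᴴ E).IsHermitian) (X : Matrix ν π ℂ) :
    posInertia (fromBlocks A G Gᴴ E) hN ≤
      posInertia (quad A G E X) (quad_isHermitian hA hE X) + (fromCols E Gᴴ).rank :=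
  (posInertia_le_add_rank _ hN _ _ _ (fromBlocks_eq_add A G hE X)).trans
    (Nat.add_le_add_left (rank_fromCols_smul_le G E X) _)

theorem posInertia_quad_le (hA : A.IsHermitian) (hE : E.IsHermitian)
    (hN : (fromBlocks A G Gᴴ E).IsHermitian) (X : Matrix ν π ℂ) :
    posInertia (quad A G E X) (quad_isHermitian hA hE X) ≤ posInertia (fromBlocks A G Gᴴ E) hN :=
  posInertia_mul_mul_conjTranspose_le hN _ _ (quad_eq_mul_mul A G E X)

omit [DecidableEq π] in
theorem rank_quad_le (A : Matrix ν ν ℂ) (G : Matrix ν π ℂ) (E : Matrix π π ℂ)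
    (X : Matrix ν π ℂ) : (quad A G E X).rank ≤ (fromBlocks A G Gᴴ E).rank := by
  rw [quad_eq_mul_mul]
  exact (rank_mul_le_left _ _).trans (rank_mul_le_right _ _)

/-- A Hermitian matrix commutes with some Hermitian generalized inverse. -/
theorem exists_pinv {H : Matrix ν ν ℂ} (hH : H.IsHermitian) :
    ∃ R : Matrix ν ν ℂ, R.IsHermitian ∧ R * H = H * R ∧ H * R * H = H := by
  set U := (hH.eigenvectorUnitary : Matrix ν ν ℂ)
  have hU : Uᴴ * U = 1 := eigenvectorUnitary_conjTranspose_mul hH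
  have e : ∀ d d' : ν → ℂ, (U * diagonal d * Uᴴ) * (U * diagonal d' * Uᴴ) =
      U * diagonal (d * d') * Uᴴ := fun d d' => by
    rw [show (U * diagonal d * Uᴴ) * (U * diagonal d' * Uᴴ) =
      U * diagonal d * (Uᴴ * U) * diagonal d' * Uᴴ by simp only [Matrix.mul_assoc], hU,
      Matrix.mul_one, Matrix.mul_assoc U, diagonal_mul_diagonal]
    rfl
  have hd : H = U * diagonal (fun i => (hH.eigenvalues i : ℂ)) * Uᴴ := eq_mul_diagonal_mul hH
  refine ⟨U * diagonal (fun i => ((hH.eigenvalues i)⁻¹ : ℂ)) * Uᴴ,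
    isHermitian_mul_mul_conjTranspose _ (isHermitian_diagonal_iff.2 fun i => ?_), ?_, ?_⟩
  · simp [IsSelfAdjoint]
  · conv_lhs => enter [2]; rw [hd]
    conv_rhs => enter [1]; rw [hd]
    rw [e, e, mul_comm]
  · have : H * (U * diagonal (fun i => ((hH.eigenvalues i)⁻¹ : ℂ)) * Uᴴ) * H =
        U * diagonal (fun i => (hH.eigenvalues i : ℂ)) * Uᴴ := by
      conv_lhs => enter [1, 1]; rw [hd]
      conv_lhs => enter [2]; rw [hd]
      rw [e, e]
      congr 3
      ext i
      by_cases h : hH.eigenvalues i = 0 <;> simp [h]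
    exact this.trans hd.symm

/-- After a shift of `X` the blocks of the form become mutually orthogonal. -/
theorem exists_shift_orthogonal (hA : A.IsHermitian) (hE : E.IsHermitian) (G : Matrix ν π ℂ) :
    ∃ X : Matrix ν π ℂ, quad A G E X * (G + X * E) = 0 ∧ (G + X * E) * E = 0 := by
  obtain ⟨R, -, hRE, hERE⟩ := exists_pinv hE
  -- The first shift, by -GR, removes the part of G that E sees: H = G(1 - RE).
  set H := G + -(G * R) * E with hH
  have hHE : H * E = 0 := by
    rw [hH, Matrix.neg_mul, Matrix.add_mul, Matrix.neg_mul, Matrix.mul_assoc G R E, hRE,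
      Matrix.mul_assoc G, hERE, add_neg_cancel]
  obtain ⟨S, hS, hcomm, hSS⟩ := exists_pinv (isHermitian_mul_conjTranspose_self H)
  set A' := quad A G E (-(G * R)) with hA'
  have hA'h : A'.IsHermitian := quad_isHermitian hA hE _
  -- Q is the orthogonal projection onto the range of H.
  set Q := H * Hᴴ * S with hQ
  have hQh : Qᴴ = Q := by
    rw [hQ, conjTranspose_mul, (isHermitian_mul_conjTranspose_self H).eq, hS.eq, hcomm]
  have hQH : Q * H = H := by
    have : (Q - 1) * (H * Hᴴ) = 0 := by
      rw [Matrix.sub_mul, Matrix.one_mul, hSS, sub_self]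
    rw [mul_self_mul_conjTranspose_eq_zero, Matrix.sub_mul, Matrix.one_mul, sub_eq_zero] at this
    exact this
  have hSH : S * H * Hᴴ = Q := by rw [Matrix.mul_assoc, hcomm]
  -- The second shift has SH as right factor. Since HE = 0, it leaves H unchanged and its quadratic
  -- term vanishes. Its left factor is chosen so that the two linear terms turn A' into (1 - Q)A'(1
  -- - Q), with ½ splitting QA'Q between them.
  have e1 : G + (-(G * R) + (-((1 - Q) * A' + (1 / 2 : ℂ) • (Q * A'))) * (S * H)) * E = H := by
    rw [Matrix.add_mul, ← add_assoc, ← hH, Matrix.mul_assoc, Matrix.mul_assoc S, hHE]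
    simp
  refine ⟨-(G * R) + (-((1 - Q) * A' + (1 / 2 : ℂ) • (Q * A'))) * (S * H), ?_, ?_⟩
  · rw [e1, quad_add _ _ hE, ← hH, ← hA']
    have e2 : quad A' H E ((-((1 - Q) * A' + (1 / 2 : ℂ) • (Q * A'))) * (S * H)) =
        (1 - Q) * A' * (1 - Q) := by
      have t1 : ∀ V : Matrix ν ν ℂ, V * (S * H) * E = 0 := fun V => by
        rw [Matrix.mul_assoc, Matrix.mul_assoc, hHE]; simp
      have t2 : ∀ V : Matrix ν ν ℂ, V * (S * H) * Hᴴ = V * Q := fun V => by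
        rw [Matrix.mul_assoc, hSH]
      have t3 : ∀ V : Matrix ν ν ℂ, H * (V * (S * H))ᴴ = Q * Vᴴ := fun V => by
        rw [conjTranspose_mul, conjTranspose_mul, hS.eq, ← Matrix.mul_assoc, ← Matrix.mul_assoc]
      rw [quad, t1, t2, t3]
      have h2 : star (1 / 2 : ℂ) = 1 / 2 := by simp
      simp only [conjTranspose_neg, conjTranspose_add, conjTranspose_smul, h2, conjTranspose_mul,
        conjTranspose_sub, hQh, hA'h.eq, Matrix.zero_mul, Matrix.add_mul,
        Matrix.sub_mul, Matrix.mul_sub, Matrix.mul_add, Matrix.one_mul, Matrix.mul_one,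
        Matrix.smul_mul, Matrix.mul_smul, Matrix.neg_mul, Matrix.mul_neg, Matrix.mul_assoc]
      module
    rw [e2, Matrix.mul_assoc, Matrix.sub_mul 1 Q H, hQH, Matrix.one_mul, sub_self, Matrix.mul_zero]
  · rw [e1, hHE]

end Quad

/-! ### Attaining the minima: splitting the form and cancelling eigenvalues -/

section Minimal

variable {ν π ι κ μ : Type*} [Fintype ν] [DecidableEq ν] [Fintype π] [DecidableEq π]
  [Fintype ι] [DecidableEq ι] [Fintype κ] [DecidableEq κ] [Fintype μ] [DecidableEq μ]

omit [DecidableEq ι] [DecidableEq κ] [DecidableEq μ] in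
theorem posDef_conjTranspose_fromCols_mul_mul {N : Matrix ι ι ℂ} (hN : N.IsHermitian)
    (T : Matrix ι κ ℂ) (V : Matrix ι μ ℂ) (hT : (Tᴴ * N * T).PosDef) (hV : (Vᴴ * N * V).PosDef)
    (h : Tᴴ * N * V = 0) : ((fromCols T V)ᴴ * N * fromCols T V).PosDef := by
  have h' : Vᴴ * N * T = 0 := by
    rw [← conjTranspose_eq_zero]
    simpa [hN.eq, Matrix.mul_assoc] using h
  refine PosDef.of_dotProduct_mulVec_pos (isHermitian_conjTranspose_mul_mul _ hN) fun x hx => ?_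
  rw [conjTranspose_fromCols_eq_fromRows_conjTranspose, fromRows_mul, fromRows_mul_fromCols, h, h',
    fromBlocks_mulVec, ← Sum.elim_comp_inl_inr (star x), sumElim_dotProduct_sumElim]
  simp only [zero_mulVec, add_zero, zero_add]
  by_cases h1 : x ∘ Sum.inl = 0
  · have h2 : x ∘ Sum.inr ≠ 0 := fun h2 => hx (by
      rw [← Sum.elim_comp_inl_inr x, h1, h2]; ext (i | i) <;> rfl)
    exact add_pos_of_nonneg_of_pos (hT.posSemidef.dotProduct_mulVec_nonneg _)
      (hV.dotProduct_mulVec_pos h2)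
  · exact add_pos_of_pos_of_nonneg (hT.dotProduct_mulVec_pos h1)
      (hV.posSemidef.dotProduct_mulVec_nonneg _)

omit [Fintype μ] [DecidableEq μ] in
-- Eigenvectors with nonzero eigenvalue lie in the range of A, which K kills.
theorem mul_eigenCols_eq_zero {A : Matrix ι ι ℂ} (hA : A.IsHermitian) (f : κ → ι)
    (hf : ∀ i, hA.eigenvalues (f i) ≠ 0) (K : Matrix μ ι ℂ) (hK : K * A = 0) :
    K * eigenCols hA f = 0 := by
  have h : K * eigenCols hA f * diagonal (fun i => (hA.eigenvalues (f i) : ℂ)) = 0 := by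
    rw [Matrix.mul_assoc, ← mul_eigenCols, ← Matrix.mul_assoc, hK, Matrix.zero_mul]
  ext i j
  have := congrFun (congrFun h i) j
  rw [mul_diagonal] at this
  simpa [hf j] using this

/-- Three mutually orthogonal families for the form: (v, 0) and (0, w) with v, w positive
eigenvectors of A, E, and (u, Gᴴu) with u an eigenvector of GGᴴ of nonzero eigenvalue. On the span
of the last the form is 2‖Gᴴu‖², because Au = 0 and EGᴴ = 0. -/
theorem posInertia_add_le_fromBlocks {A : Matrix ν ν ℂ} {G : Matrix ν π ℂ} {E : Matrix π π ℂ}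
    (hA : A.IsHermitian) (hE : E.IsHermitian) (hN : (fromBlocks A G Gᴴ E).IsHermitian)
    (hAG : A * G = 0) (hGE : G * E = 0) :
    posInertia A hA + posInertia E hE + G.rank ≤ posInertia (fromBlocks A G Gᴴ E) hN := by
  have hGA : Gᴴ * A = 0 := by
    rw [← conjTranspose_eq_zero, conjTranspose_mul, conjTranspose_conjTranspose, hA.eq, hAG]
  have hEG : E * Gᴴ = 0 := by
    rw [← conjTranspose_eq_zero, conjTranspose_mul, conjTranspose_conjTranspose, hE.eq, hGE]
  have hH : (G * Gᴴ).IsHermitian := isHermitian_mul_conjTranspose_self G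
  set V := eigenCols hA (fun i : {i // 0 < hA.eigenvalues i} => (i : ν)) with hVdef
  set W := eigenCols hE (fun i : {i // 0 < hE.eigenvalues i} => (i : π)) with hWdef
  set J := eigenCols hH (fun i : {i // hH.eigenvalues i ≠ 0} => (i : ν)) with hJdef
  have hV : Gᴴ * V = 0 := mul_eigenCols_eq_zero hA _ (fun i => i.2.ne') _ hGA
  have hV' : Vᴴ * G = 0 := by
    rw [← conjTranspose_eq_zero, conjTranspose_mul, conjTranspose_conjTranspose, hV]
  have hW : G * W = 0 := mul_eigenCols_eq_zero hE _ (fun i => i.2.ne') _ hGE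
  have hW' : Wᴴ * Gᴴ = 0 := by
    rw [← conjTranspose_eq_zero, conjTranspose_mul, conjTranspose_conjTranspose,
      conjTranspose_conjTranspose, hW]
  have hJ : A * J = 0 := mul_eigenCols_eq_zero hH _ (fun i => i.2) _ (by
    rw [← Matrix.mul_assoc, hAG, Matrix.zero_mul])
  have key : ((fromCols (fromCols (fromRows V (0 : Matrix π _ ℂ)) (fromRows (0 : Matrix ν _ ℂ) W))
      (fromRows J (Gᴴ * J)))ᴴ * fromBlocks A G Gᴴ E *
      fromCols (fromCols (fromRows V (0 : Matrix π _ ℂ)) (fromRows (0 : Matrix ν _ ℂ) W))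
      (fromRows J (Gᴴ * J))).PosDef := by
    refine posDef_conjTranspose_fromCols_mul_mul hN _ _
      (posDef_conjTranspose_fromCols_mul_mul hN _ _ ?_ ?_ ?_) ?_ ?_
    · have : (fromRows V (0 : Matrix π _ ℂ))ᴴ * fromBlocks A G Gᴴ E *
          fromRows V (0 : Matrix π _ ℂ) = Vᴴ * A * V := by
        simp [conjTranspose_fromRows_eq_fromCols_conjTranspose, fromCols_mul_fromBlocks,
          fromCols_mul_fromRows]
      rw [this]
      exact exists_posDef_of_posInertia hA
    · have : (fromRows (0 : Matrix ν _ ℂ) W)ᴴ * fromBlocks A G Gᴴ E *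
          fromRows (0 : Matrix ν _ ℂ) W = Wᴴ * E * W := by
        simp [conjTranspose_fromRows_eq_fromCols_conjTranspose, fromCols_mul_fromBlocks,
          fromCols_mul_fromRows]
      rw [this]
      exact exists_posDef_of_posInertia hE
    · simp [conjTranspose_fromRows_eq_fromCols_conjTranspose, fromCols_mul_fromBlocks,
        fromCols_mul_fromRows, hV']
    · have : (fromRows J (Gᴴ * J))ᴴ * fromBlocks A G Gᴴ E * fromRows J (Gᴴ * J) =
          Jᴴ * (G * Gᴴ) * J + Jᴴ * (G * Gᴴ) * J := by
        simp only [conjTranspose_fromRows_eq_fromCols_conjTranspose, fromCols_mul_fromBlocks,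
          fromCols_mul_fromRows, conjTranspose_mul, conjTranspose_conjTranspose, Matrix.add_mul,
          Matrix.mul_assoc, hJ]
        rw [← Matrix.mul_assoc E Gᴴ, hEG]
        simp
      rw [this]
      have hp : (Jᴴ * (G * Gᴴ) * J).PosDef := by
        rw [conjTranspose_eigenCols_mul_mul hH Subtype.val_injective, Matrix.posDef_diagonal_iff]
        intro i
        have := (posSemidef_self_mul_conjTranspose G).eigenvalues_nonneg i
        simpa using lt_of_le_of_ne this i.2.symm
      exact hp.add hp
    · rw [conjTranspose_fromCols_eq_fromRows_conjTranspose]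
      simp only [conjTranspose_fromRows_eq_fromCols_conjTranspose, fromRows_mul,
        fromCols_mul_fromBlocks, fromCols_mul_fromRows, conjTranspose_zero, Matrix.zero_mul,
        add_zero, zero_add, hV', hW', Matrix.mul_assoc, hJ]
      rw [← Matrix.mul_assoc E Gᴴ, hEG]
      simp
  have := card_le_posInertia hN _ key
  rw [Fintype.card_sum, Fintype.card_sum, card_subtype_eq_posInertia, card_subtype_eq_posInertia,
    ← hH.rank_eq_card_non_zero_eigs, rank_self_mul_conjTranspose] at this
  exact this

omit [Fintype ν] [DecidableEq π] [Fintype π] in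
-- Truncated subtraction: nothing in P stays unmatched when Q is at least as large.
theorem exists_partial_matching (P : Finset ν) (Q : Finset π) :
    ∃ g : ν → Option π, (∀ j k, g j = some k → j ∈ P ∧ k ∈ Q) ∧
      (∀ i j k, g i = some k → g j = some k → i = j) ∧
      (P.filter fun j => g j = none).card ≤ P.card - Q.card := by
  obtain ⟨P', hP', hPc⟩ := Finset.exists_subset_card_eq (min_le_left P.card Q.card)
  obtain ⟨Q', hQ', hQc⟩ := Finset.exists_subset_card_eq (min_le_right P.card Q.card)
  let e := Finset.equivOfCardEq (hPc.trans hQc.symm)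
  refine ⟨fun j => if h : j ∈ P' then some (e ⟨j, h⟩ : π) else none, ?_, ?_, ?_⟩
  · intro j k h
    by_cases hj : j ∈ P'
    · simp only [hj, dite_true, Option.some.injEq] at h
      exact ⟨hP' hj, h ▸ hQ' (e ⟨j, hj⟩).2⟩
    · simp [hj] at h
  · intro i j k hi hj
    by_cases hi' : i ∈ P'
    · by_cases hj' : j ∈ P'
      · simp only [hi', hj', dite_true, Option.some.injEq] at hi hj
        have := e.injective (Subtype.ext (hi.trans hj.symm))
        exact congrArg Subtype.val this
      · simp [hj'] at hj
    · simp [hi'] at hi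
  · have : (P.filter fun j => (if h : j ∈ P' then some (e ⟨j, h⟩ : π) else none) = none) ⊆
        P \ P' := by
      intro j hj
      simp only [Finset.mem_filter] at hj
      rw [Finset.mem_sdiff]
      exact ⟨hj.1, fun h => by simp [h] at hj⟩
    refine (Finset.card_le_card this).trans ?_
    rw [Finset.card_sdiff_of_subset hP', hPc]
    omega

/-- Each positive eigenvalue of A is cancelled by a negative one of E, and vice versa, as far as the
supply lasts; truncated subtraction counts what is left. -/
theorem exists_quad_inertia_le {A : Matrix ν ν ℂ} {G : Matrix ν π ℂ} {E : Matrix π π ℂ}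
    (hA : A.IsHermitian) (hE : E.IsHermitian) (hGE : G * E = 0) :
    ∃ X : Matrix ν π ℂ,
      posInertia (quad A G E X) (quad_isHermitian hA hE X) ≤
        posInertia A hA - negInertia E hE ∧
      negInertia (quad A G E X) (quad_isHermitian hA hE X) ≤
        negInertia A hA - posInertia E hE := by
  have hEG : E * Gᴴ = 0 := by
    rw [← conjTranspose_eq_zero, conjTranspose_mul, conjTranspose_conjTranspose, hE.eq, hGE]
  obtain ⟨g₁, h₁, i₁, c₁⟩ := exists_partial_matching
    (Finset.univ.filter fun i => 0 < hA.eigenvalues i)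
    (Finset.univ.filter fun i => hE.eigenvalues i < 0)
  obtain ⟨g₂, h₂, i₂, c₂⟩ := exists_partial_matching
    (Finset.univ.filter fun i => hA.eigenvalues i < 0)
    (Finset.univ.filter fun i => 0 < hE.eigenvalues i)
  simp only [Finset.mem_filter, Finset.mem_univ, true_and] at h₁ h₂
  set l := hA.eigenvalues with hl
  set e := hE.eigenvalues with he
  -- On a zero eigenvalue `g₂` is `none`, so this test suffices. The merged matching stays injective
  -- because the two targets differ in the sign of `e k`.
  let g : ν → Option π := fun j => if 0 < l j then g₁ j else g₂ j
  have hg : ∀ j k, g j = some k → (0 < l j ∧ e k < 0 ∧ g₁ j = some k) ∨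
      (l j < 0 ∧ 0 < e k ∧ g₂ j = some k) := by
    intro j k h
    by_cases hj : 0 < l j
    · simp only [g, hj, if_true] at h
      exact Or.inl ⟨hj, (h₁ j k h).2, h⟩
    · simp only [g, hj, if_false] at h
      exact Or.inr ⟨(h₂ j k h).1, (h₂ j k h).2, h⟩
  have gi : ∀ i j k, g i = some k → g j = some k → i = j := by
    intro i j k hi hj
    rcases hg i k hi with ⟨-, a, b⟩ | ⟨-, a, b⟩ <;> rcases hg j k hj with ⟨-, c, d⟩ | ⟨-, c, d⟩
    · exact i₁ i j k b d
    · exact absurd a c.not_gt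
    · exact absurd a c.not_gt
    · exact i₂ i j k b d
  -- The entry solves l j + x² (e k)³ = 0. The cube arises because X below carries a factor E,
  -- giving E·E·E in X E Xᴴ; matched eigenvalues have opposite signs, so the root is real.
  let M : Matrix ν π ℂ := fun j k =>
    if g j = some k then ((Real.sqrt (-l j / e k ^ 3) : ℝ) : ℂ) else 0
  let d : ν → ℝ := fun j => if g j = none then l j else 0
  set D : Matrix π π ℂ := diagonal fun k => (e k : ℂ) with hD
  have hM : diagonal (fun j => (l j : ℂ)) + M * (D * D * D) * Mᴴ =
      diagonal (fun j => (d j : ℂ)) := by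
    have hD3 : D * D * D = diagonal fun k => ((e k ^ 3 : ℝ) : ℂ) := by
      rw [hD, diagonal_mul_diagonal, diagonal_mul_diagonal]
      congr 1; ext k; push_cast; ring
    rw [hD3]
    ext i j
    rw [Matrix.add_apply, mul_apply]
    simp only [mul_diagonal, conjTranspose_apply]
    rcases hgi : g i with _ | k
    · have : ∀ k, M i k = 0 := fun k => by simp [M, hgi]
      simp [this, diagonal_apply, d, hgi]
    · have hs : ∀ k', k' ≠ k → M i k' = 0 := fun k' hk' => by
        simp only [M, hgi, Option.some.injEq, hk'.symm, if_false]
      rw [Finset.sum_eq_single k (fun k' _ hk' => by rw [hs k' hk']; simp) (by simp)]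
      by_cases hij : i = j
      · subst hij
        have hpos : 0 ≤ -l i / e k ^ 3 := by
          rcases hg i k hgi with ⟨a, b, -⟩ | ⟨a, b, -⟩
          · exact div_nonneg_of_nonpos (by linarith) (Odd.pow_neg (by decide) b).le
          · exact div_nonneg (by linarith) (by positivity)
        have hne : e k ^ 3 ≠ 0 := by
          rcases hg i k hgi with ⟨-, b, -⟩ | ⟨-, b, -⟩
          · exact pow_ne_zero _ b.ne
          · exact pow_ne_zero _ b.ne'
        have hr : l i + Real.sqrt (-l i / e k ^ 3) * e k ^ 3 * Real.sqrt (-l i / e k ^ 3) = 0 := by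
          rw [mul_right_comm, Real.mul_self_sqrt hpos, div_mul_cancel₀ _ hne, add_neg_cancel]
        simp only [diagonal_apply_eq, M, hgi, if_true, d, Complex.star_def, Complex.conj_ofReal]
        rw [← Complex.ofReal_mul, ← Complex.ofReal_mul, ← Complex.ofReal_add, hr]
        simp
      · have : M j k = 0 := by
          have : g j ≠ some k := fun h => hij (gi i j k hgi h)
          simp [M, this]
        simp [this, diagonal_apply_ne _ hij]
  set U := (hA.eigenvectorUnitary : Matrix ν ν ℂ)
  set W := (hE.eigenvectorUnitary : Matrix π π ℂ)
  have hW : Wᴴ * W = 1 := eigenvectorUnitary_conjTranspose_mul hE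
  have hEW : E * W = W * D := mul_eigenvectorUnitary hE
  -- The right factor E kills the linear terms, since EGᴴ = 0.
  let X : Matrix ν π ℂ := U * M * Wᴴ * E
  have hX : X * Gᴴ = 0 := by simp only [X, Matrix.mul_assoc, hEG, Matrix.mul_zero]
  have hX' : G * Xᴴ = 0 := by
    rw [← conjTranspose_eq_zero, conjTranspose_mul, conjTranspose_conjTranspose, hX]
  have hXE : X * E * Xᴴ = U * (M * (D * D * D) * Mᴴ) * Uᴴ := by
    have hEW' : ∀ Y : Matrix π ν ℂ, E * (W * Y) = W * (D * Y) := fun Y => by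
      rw [← Matrix.mul_assoc, hEW, Matrix.mul_assoc]
    have hWW : ∀ Y : Matrix π ν ℂ, Wᴴ * (W * Y) = Y := fun Y => by
      rw [← Matrix.mul_assoc, hW, Matrix.one_mul]
    simp only [X, conjTranspose_mul, conjTranspose_conjTranspose, hE.eq, Matrix.mul_assoc, hEW',
      hWW]
  have hq : quad A G E X = U * diagonal (fun j => (d j : ℂ)) * Uᴴ := by
    rw [quad, hX, hX', hXE, add_zero, add_zero, ← hM, Matrix.mul_add, Matrix.add_mul]
    congr 1
    exact eq_mul_diagonal_mul hA
  refine ⟨X, ?_, ?_⟩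
  · refine (posInertia_le_card_diagonal _ d U hq).trans (le_trans (Finset.card_le_card ?_) c₁)
    intro j hj
    simp only [Finset.mem_filter, Finset.mem_univ, true_and] at hj ⊢
    by_cases h : g j = none
    · simp only [d, h, if_true] at hj
      refine ⟨hj, ?_⟩
      simpa only [g, hj, if_true] using h
    · simp [d, h] at hj
  · rw [← posInertia_neg]
    refine (posInertia_le_card_diagonal _ (fun j => - d j) U ?_).trans
      (le_trans (Finset.card_le_card ?_) c₂)
    · have : (diagonal fun j => ((-d j : ℝ) : ℂ)) = - diagonal fun j => (d j : ℂ) := by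
        ext i j; by_cases hij : i = j <;> simp [hij]
      rw [this, hq, Matrix.mul_neg, Matrix.neg_mul]
    · intro j hj
      simp only [Finset.mem_filter, Finset.mem_univ, true_and] at hj ⊢
      by_cases h : g j = none
      · simp only [d, h, if_true] at hj
        have hj' : l j < 0 := by linarith
        refine ⟨hj', ?_⟩
        simpa only [g, hj'.not_gt, if_false] using h
      · simp [d, h] at hj

omit [Fintype ν] [DecidableEq ν] [Fintype π] [DecidableEq π] in
theorem neg_fromBlocks_eq (A : Matrix ν ν ℂ) (G : Matrix ν π ℂ) (E : Matrix π π ℂ) :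
    -fromBlocks A G Gᴴ E = fromBlocks (-A) (-G) (-G)ᴴ (-E) := by
  rw [fromBlocks_neg, conjTranspose_neg]

omit [Fintype ν] [DecidableEq ν] [DecidableEq π] in
theorem quad_neg (A : Matrix ν ν ℂ) (G : Matrix ν π ℂ) (E : Matrix π π ℂ) (X : Matrix ν π ℂ) :
    quad (-A) (-G) (-E) X = -quad A G E X := by
  simp only [quad, conjTranspose_neg, Matrix.mul_neg, Matrix.neg_mul]
  abel

theorem posInertia_congr {A B : Matrix ν ν ℂ} (h : A = B) (hA : A.IsHermitian)
    (hB : B.IsHermitian) : posInertia A hA = posInertia B hB := by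
  subst h; rfl

theorem negInertia_add_le_fromBlocks {A : Matrix ν ν ℂ} {G : Matrix ν π ℂ} {E : Matrix π π ℂ}
    (hA : A.IsHermitian) (hE : E.IsHermitian) (hN : (fromBlocks A G Gᴴ E).IsHermitian)
    (hAG : A * G = 0) (hGE : G * E = 0) :
    negInertia A hA + negInertia E hE + G.rank ≤ negInertia (fromBlocks A G Gᴴ E) hN := by
  have := posInertia_add_le_fromBlocks (G := -G) hA.neg hE.neg
    (neg_fromBlocks_eq A G E ▸ hN.neg) (by simpa using hAG) (by simpa using hGE)
  rw [posInertia_neg, posInertia_neg, ← posInertia_congr (neg_fromBlocks_eq A G E) hN.neg,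
    posInertia_neg] at this
  have hr : (-G).rank = G.rank := le_antisymm
    (by simpa using rank_mul_le_left G (-1 : Matrix π π ℂ))
    (by simpa using rank_mul_le_left (-G) (-1 : Matrix π π ℂ))
  rwa [hr] at this

omit [Fintype ν] [DecidableEq ν] [Fintype π] [DecidableEq π] in
theorem fromBlocks_isHermitian {A : Matrix ν ν ℂ} {E : Matrix π π ℂ} (hA : A.IsHermitian)
    (hE : E.IsHermitian) (G : Matrix ν π ℂ) : (fromBlocks A G Gᴴ E).IsHermitian :=
  IsHermitian.fromBlocks hA rfl hE

theorem negInertia_mul_mul_conjTranspose_le {A : Matrix κ κ ℂ} (hA : A.IsHermitian)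
    {N : Matrix ι ι ℂ} (hN : N.IsHermitian) (S : Matrix ι κ ℂ) (h : N = S * A * Sᴴ) :
    negInertia N hN ≤ negInertia A hA := by
  rw [← posInertia_neg, ← posInertia_neg]
  exact posInertia_mul_mul_conjTranspose_le _ _ S (by rw [h, Matrix.mul_neg, Matrix.neg_mul])

/-- One matrix `X` minimizes both partial inertias of the form. -/
theorem exists_quad_inertia_le_sub {A : Matrix ν ν ℂ} {E : Matrix π π ℂ}
    (hA : A.IsHermitian) (hE : E.IsHermitian) (G : Matrix ν π ℂ)
    (hN : (fromBlocks A G Gᴴ E).IsHermitian) :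
    ∃ X : Matrix ν π ℂ,
      posInertia (quad A G E X) (quad_isHermitian hA hE X) ≤
        posInertia (fromBlocks A G Gᴴ E) hN - (fromCols E Gᴴ).rank ∧
      negInertia (quad A G E X) (quad_isHermitian hA hE X) ≤
        negInertia (fromBlocks A G Gᴴ E) hN - (fromCols E Gᴴ).rank := by
  obtain ⟨X₀, h1, h2⟩ := exists_shift_orthogonal hA hE G
  have hA' : (quad A G E X₀).IsHermitian := quad_isHermitian hA hE X₀
  obtain ⟨Y, hp, hn⟩ := exists_quad_inertia_le (G := G + X₀ * E) hA' hE h2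
  have hN' := fromBlocks_isHermitian hA' hE (G + X₀ * E)
  have ap := posInertia_add_le_fromBlocks hA' hE hN' h1 h2
  have an := negInertia_add_le_fromBlocks hA' hE hN' h1 h2
  have bp := posInertia_mul_mul_conjTranspose_le hN hN' _ (fromBlocks_quad_eq A G hE X₀)
  have bn := negInertia_mul_mul_conjTranspose_le hN hN' _ (fromBlocks_quad_eq A G hE X₀)
  have hr : (fromCols E Gᴴ).rank ≤ E.rank + (G + X₀ * E).rank := by
    have : fromCols E Gᴴ = E * fromCols (1 : Matrix π π ℂ) (-X₀ᴴ) +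
        (G + X₀ * E)ᴴ * fromCols (0 : Matrix ν π ℂ) (1 : Matrix ν ν ℂ) := by
      rw [mul_fromCols, mul_fromCols]
      ext i (j | j)
      · simp
      · simp [hE.eq]
    rw [this]
    refine (rank_add_le _ _).trans (add_le_add (rank_mul_le_left _ _) ?_)
    rw [← rank_conjTranspose (G + X₀ * E)]
    exact rank_mul_le_left _ _
  -- With A', G' the shifted blocks, i₊(N) - rank [E, Gᴴ] ≥ i₊(A') + i₊(E) + rank G' - (i₊(E) +
  -- i₋(E) + rank G') = i₊(A') - i₋(E), the bound reached by Y; likewise for i₋.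
  rw [rank_eq_posInertia_add_negInertia hE] at hr
  have hq := quad_add A G hE X₀ Y
  refine ⟨X₀ + Y, ?_, ?_⟩
  · rw [posInertia_congr hq _ (quad_isHermitian hA' hE Y)]
    omega
  · rw [← posInertia_neg, posInertia_congr (congrArg Neg.neg hq) _ (quad_isHermitian hA' hE Y).neg,
      posInertia_neg (quad_isHermitian hA' hE Y)]
    omega

end Minimal

/-! ### Attaining the maxima: perturbing subspaces into graphs -/

section Maximal

open Filter Topology

variable {ν π ι κ : Type*} [Fintype ν] [DecidableEq ν] [Fintype π] [DecidableEq π]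
  [Fintype ι] [DecidableEq ι] [Fintype κ] [DecidableEq κ]

omit [DecidableEq κ] in
-- Positivity on the compact unit sphere survives small perturbations, and homogeneity extends it to
-- all nonzero vectors.
theorem eventually_posDef {P : Matrix κ κ ℂ} (hP : P.PosDef) :
    ∀ᶠ Q in 𝓝 P, Q.IsHermitian → Q.PosDef := by
  have hc : Continuous fun q : Matrix κ κ ℂ × (κ → ℂ) => (star q.2 ⬝ᵥ q.1 *ᵥ q.2).re :=
    Complex.continuous_re.comp
      (Continuous.dotProduct continuous_snd.star (continuous_fst.matrix_mulVec continuous_snd))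
  have := (isCompact_sphere (0 : κ → ℂ) 1).eventually_forall_of_forall_eventually
    (x₀ := P) (P := fun Q x => 0 < (star x ⬝ᵥ Q *ᵥ x).re) (fun x hx =>
      hc.continuousAt.eventually (lt_mem_nhds (by
        have hne : x ≠ 0 := by
          rintro rfl
          simp at hx
        exact (Complex.pos_iff.1 (hP.dotProduct_mulVec_pos hne)).1)))
  filter_upwards [this] with Q hQ hH
  refine PosDef.of_dotProduct_mulVec_pos hH fun x hx => ?_
  rw [Complex.pos_iff]
  refine ⟨?_, (hH.im_star_dotProduct_mulVec_self x).symm⟩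
  have hn : ‖x‖ ≠ 0 := norm_ne_zero_iff.2 hx
  have h1 := hQ ((‖x‖⁻¹ : ℝ) • x) (by simp [norm_smul, hn])
  have h2 : (star ((‖x‖⁻¹ : ℝ) • x) ⬝ᵥ Q *ᵥ ((‖x‖⁻¹ : ℝ) • x)).re =
      ‖x‖⁻¹ * (‖x‖⁻¹ * (star x ⬝ᵥ Q *ᵥ x).re) := by
    rw [star_smul, mulVec_smul, smul_dotProduct, dotProduct_smul]
    simp
  rw [h2] at h1
  have hi : 0 < ‖x‖⁻¹ := by positivity
  exact (mul_pos_iff_of_pos_left hi).1 ((mul_pos_iff_of_pos_left hi).1 h1)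

omit [DecidableEq π] in
/-- Graphs are dense: any restriction of the full form to a subspace of dimension at most `card ν`
is approximated by restrictions of the matrices `quad A G E X`. -/
theorem exists_conjTranspose_mul_quad_mul_mem (A : Matrix ν ν ℂ) (G : Matrix ν π ℂ)
    (E : Matrix π π ℂ) (T : Matrix (ν ⊕ π) κ ℂ) (hκ : Fintype.card κ ≤ Fintype.card ν)
    {S : Set (Matrix κ κ ℂ)} (hS : S ∈ 𝓝 (Tᴴ * fromBlocks A G Gᴴ E * T)) :
    ∃ (X : Matrix ν π ℂ) (V : Matrix ν κ ℂ), Vᴴ * quad A G E X * V ∈ S := by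
  obtain ⟨f⟩ := Function.Embedding.nonempty_of_card_le hκ
  let J : Matrix ν κ ℂ := (1 : Matrix ν ν ℂ).submatrix id f
  have hJ : Jᴴ * J = 1 := by
    ext i j
    simp [J, Matrix.mul_apply, Matrix.one_apply, f.injective.eq_iff, eq_comm]
  let F : Matrix (ν ⊕ π) κ ℂ := fromRows J 0
  have hc : Continuous fun c : ℂ => (T + c • F)ᴴ * fromBlocks A G Gᴴ E * (T + c • F) := by
    have h1 : Continuous fun c : ℂ => T + c • F := by fun_prop
    exact (h1.matrix_conjTranspose.matrix_mul continuous_const).matrix_mul h1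
  have ev1 : ∀ᶠ c in 𝓝[≠] (0 : ℂ), (T + c • F)ᴴ * fromBlocks A G Gᴴ E * (T + c • F) ∈ S := by
    refine (hc.continuousAt.eventually ?_).filter_mono nhdsWithin_le_nhds
    simpa using hS
  -- JᴴV = JᴴT₁ + c is singular only when -c is an eigenvalue of JᴴT₁, which excludes finitely many
  -- c.
  have ev2 : ∀ᶠ c in 𝓝[≠] (0 : ℂ), -c ∉ spectrum ℂ (Jᴴ * T.toRows₁) :=
    Filter.Eventually.filter_mono (nhdsNE_le_cofinite (a := (0 : ℂ)))
      ((Matrix.finite_spectrum (Jᴴ * T.toRows₁)).preimage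
        neg_injective.injOn).eventually_cofinite_notMem
  obtain ⟨c, hc1, hc2⟩ := (ev1.and ev2).exists
  set V := T.toRows₁ + c • J with hV
  have hu : IsUnit (Jᴴ * V) := by
    rw [spectrum.notMem_iff] at hc2
    have : Jᴴ * V = -(algebraMap ℂ (Matrix κ κ ℂ) (-c) - Jᴴ * T.toRows₁) := by
      rw [hV, Matrix.mul_add, Matrix.mul_smul, hJ, Algebra.algebraMap_eq_smul_one]
      simp [add_comm]
    rw [this]
    exact hc2.neg
  have hL : (Jᴴ * V)⁻¹ * Jᴴ * V = 1 := by
    rw [Matrix.mul_assoc, Matrix.nonsing_inv_mul _ ((Matrix.isUnit_iff_isUnit_det _).1 hu)]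
  -- (JᴴV)⁻¹Jᴴ is a left inverse of V, so Xᴴ sends the upper block V to the lower block T₂: the
  -- perturbed columns lie in the graph of Xᴴ.
  refine ⟨(T.toRows₂ * ((Jᴴ * V)⁻¹ * Jᴴ))ᴴ, V, ?_⟩
  have hT : T + c • F = (fromCols (1 : Matrix ν ν ℂ) (T.toRows₂ * ((Jᴴ * V)⁻¹ * Jᴴ))ᴴ)ᴴ * V := by
    rw [conjTranspose_fromCols_eq_fromRows_conjTranspose, conjTranspose_conjTranspose, fromRows_mul,
      Matrix.mul_assoc T.toRows₂, hL]
    ext (i | i) j <;> simp [F, V]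
  rw [quad_eq_mul_mul]
  rw [hT, conjTranspose_mul, conjTranspose_conjTranspose] at hc1
  simpa only [Matrix.mul_assoc] using hc1

theorem exists_min_le_posInertia_quad {A : Matrix ν ν ℂ} {G : Matrix ν π ℂ} {E : Matrix π π ℂ}
    (hA : A.IsHermitian) (hE : E.IsHermitian) (hN : (fromBlocks A G Gᴴ E).IsHermitian) :
    ∃ X : Matrix ν π ℂ, min (Fintype.card ν) (posInertia (fromBlocks A G Gᴴ E) hN) ≤
      posInertia (quad A G E X) (quad_isHermitian hA hE X) := by
  set k := min (Fintype.card ν) (posInertia (fromBlocks A G Gᴴ E) hN) with hk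
  obtain ⟨f⟩ : Nonempty (Fin k ↪ {i // 0 < hN.eigenvalues i}) :=
    Function.Embedding.nonempty_of_card_le (by
      rw [Fintype.card_fin, card_subtype_eq_posInertia]; exact min_le_right _ _)
  have hP : ((eigenCols hN fun i => (f i : ν ⊕ π))ᴴ * fromBlocks A G Gᴴ E *
      eigenCols hN fun i => (f i : ν ⊕ π)).PosDef := by
    rw [conjTranspose_eigenCols_mul_mul (f := fun i => (f i : ν ⊕ π)) hN
      (Subtype.val_injective.comp f.injective),
      Matrix.posDef_diagonal_iff]
    exact fun i => by simpa using (f i).2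
  obtain ⟨X, V, h⟩ := exists_conjTranspose_mul_quad_mul_mem A G E _
    (by rw [Fintype.card_fin]; exact min_le_left _ _) (eventually_posDef hP)
  refine ⟨X, ?_⟩
  have := card_le_posInertia (quad_isHermitian hA hE X) V
    (h (isHermitian_conjTranspose_mul_mul _ (quad_isHermitian hA hE X)))
  rwa [Fintype.card_fin] at this

/-- Not a consequence of the inertia maxima, which need not be reached at a common X. Here the open
condition is a nonvanishing determinant. -/
theorem exists_min_le_rank_quad {A : Matrix ν ν ℂ} {G : Matrix ν π ℂ} {E : Matrix π π ℂ}
    (hN : (fromBlocks A G Gᴴ E).IsHermitian) :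
    ∃ X : Matrix ν π ℂ, min (Fintype.card ν) (fromBlocks A G Gᴴ E).rank ≤
      (quad A G E X).rank := by
  set k := min (Fintype.card ν) (fromBlocks A G Gᴴ E).rank with hk
  obtain ⟨f⟩ : Nonempty (Fin k ↪ {i // hN.eigenvalues i ≠ 0}) :=
    Function.Embedding.nonempty_of_card_le (by
      rw [Fintype.card_fin, ← hN.rank_eq_card_non_zero_eigs]; exact min_le_right _ _)
  have hP : ((eigenCols hN fun i => (f i : ν ⊕ π))ᴴ * fromBlocks A G Gᴴ E *
      eigenCols hN fun i => (f i : ν ⊕ π)).det ≠ 0 := by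
    rw [conjTranspose_eigenCols_mul_mul (f := fun i => (f i : ν ⊕ π)) hN
      (Subtype.val_injective.comp f.injective), det_diagonal,
      Finset.prod_ne_zero_iff]
    exact fun i _ => by simpa using (f i).2
  obtain ⟨X, V, h⟩ := exists_conjTranspose_mul_quad_mul_mem A G E _
    (by rw [Fintype.card_fin]; exact min_le_left _ _)
    ((continuous_id.matrix_det.continuousAt).eventually_ne hP)
  refine ⟨X, ?_⟩
  have hu : IsUnit (Vᴴ * quad A G E X * V) :=
    (Matrix.isUnit_iff_isUnit_det _).2 (isUnit_iff_ne_zero.2 h)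
  have := rank_of_isUnit _ hu
  rw [Fintype.card_fin] at this
  rw [← this]
  exact (rank_mul_le_left _ _).trans (rank_mul_le_right _ _)

theorem exists_min_le_negInertia_quad {A : Matrix ν ν ℂ} {G : Matrix ν π ℂ} {E : Matrix π π ℂ}
    (hA : A.IsHermitian) (hE : E.IsHermitian) (hN : (fromBlocks A G Gᴴ E).IsHermitian) :
    ∃ X : Matrix ν π ℂ, min (Fintype.card ν) (negInertia (fromBlocks A G Gᴴ E) hN) ≤
      negInertia (quad A G E X) (quad_isHermitian hA hE X) := by
  obtain ⟨X, h⟩ := exists_min_le_posInertia_quad (G := -G) hA.neg hE.neg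
    (neg_fromBlocks_eq A G E ▸ hN.neg)
  refine ⟨X, ?_⟩
  rwa [← posInertia_congr (neg_fromBlocks_eq A G E) hN.neg, posInertia_neg,
    posInertia_congr (quad_neg A G E X) _ (quad_isHermitian hA hE X).neg, posInertia_neg] at h

theorem negInertia_quad_le {A : Matrix ν ν ℂ} {G : Matrix ν π ℂ} {E : Matrix π π ℂ}
    (hA : A.IsHermitian) (hE : E.IsHermitian) (hN : (fromBlocks A G Gᴴ E).IsHermitian)
    (X : Matrix ν π ℂ) :
    negInertia (quad A G E X) (quad_isHermitian hA hE X) ≤ negInertia (fromBlocks A G Gᴴ E) hN :=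
  negInertia_mul_mul_conjTranspose_le hN _ _ (quad_eq_mul_mul A G E X)

theorem negInertia_fromBlocks_le {A : Matrix ν ν ℂ} {G : Matrix ν π ℂ} {E : Matrix π π ℂ}
    (hA : A.IsHermitian) (hE : E.IsHermitian) (hN : (fromBlocks A G Gᴴ E).IsHermitian)
    (X : Matrix ν π ℂ) :
    negInertia (fromBlocks A G Gᴴ E) hN ≤
      negInertia (quad A G E X) (quad_isHermitian hA hE X) + (fromCols E Gᴴ).rank := by
  have h := posInertia_fromBlocks_le (G := -G) hA.neg hE.neg
    (neg_fromBlocks_eq A G E ▸ hN.neg) X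
  have hr : (fromCols (-E) (-G)ᴴ).rank ≤ (fromCols E Gᴴ).rank := by
    have : fromCols (-E) (-G)ᴴ = fromCols E Gᴴ * (-1 : Matrix (π ⊕ ν) (π ⊕ ν) ℂ) := by
      rw [Matrix.mul_neg, Matrix.mul_one, fromCols_neg, conjTranspose_neg]
    rw [this]
    exact rank_mul_le_left _ _
  rw [← posInertia_congr (neg_fromBlocks_eq A G E) hN.neg, posInertia_neg hN,
    posInertia_congr (quad_neg A G E X) _ (quad_isHermitian hA hE X).neg,
    posInertia_neg (quad_isHermitian hA hE X)] at h
  omega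

end Maximal

/-! ### Assembling the extremal formulas -/

theorem posInertia_le_card {ι : Type*} [Fintype ι] [DecidableEq ι] {A : Matrix ι ι ℂ}
    (hA : A.IsHermitian) : posInertia A hA ≤ Fintype.card ι :=
  Finset.card_filter_le _ _

theorem negInertia_le_card {ι : Type*} [Fintype ι] [DecidableEq ι] {A : Matrix ι ι ℂ}
    (hA : A.IsHermitian) : negInertia A hA ≤ Fintype.card ι :=
  Finset.card_filter_le _ _

theorem phi_eq_quad {n p m : ℕ} (B : Matrix (Fin p) (Fin m) ℂ) (C : Matrix (Fin n) (Fin m) ℂ)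
    {M : Matrix (Fin m) (Fin m) ℂ} (D : Matrix (Fin n) (Fin n) ℂ) (hM : M.IsHermitian)
    (X : Matrix (Fin n) (Fin p) ℂ) :
    phi B C M D X = quad (D + C * M * Cᴴ) (C * M * Bᴴ) (B * M * Bᴴ) X := by
  simp only [phi, quad, conjTranspose_add, conjTranspose_mul, conjTranspose_conjTranspose, hM.eq,
    Matrix.mul_add, Matrix.add_mul, Matrix.mul_assoc]
  abel

end QuadRankInertia

theorem mainTheorem12 (n p m : ℕ)
    (B : Matrix (Fin p) (Fin m) ℂ) (C : Matrix (Fin n) (Fin m) ℂ)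
    (M : Matrix (Fin m) (Fin m) ℂ) (D : Matrix (Fin n) (Fin n) ℂ)
    (hM : M.IsHermitian) (hD : D.IsHermitian) :
    -- maximal rank
    IsGreatest
      (Set.range fun X : Matrix (Fin n) (Fin p) ℂ => (QuadRankInertia.phi B C M D X).rank)
      (min n (QuadRankInertia.N₁ B C M D).rank) ∧
    -- minimal rank
    IsLeast
      (Set.range fun X : Matrix (Fin n) (Fin p) ℂ =>
        ((QuadRankInertia.phi B C M D X).rank : ℤ))
      (max 0 (max
        (((QuadRankInertia.N₁ B C M D).rank : ℤ) - 2 * ((QuadRankInertia.N₂ B C M).rank : ℤ))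
        (max
          ((QuadRankInertia.posInertia (QuadRankInertia.N₁ B C M D)
              (QuadRankInertia.N₁_isHermitian B C hM hD) : ℤ)
            - ((QuadRankInertia.N₂ B C M).rank : ℤ))
          ((QuadRankInertia.negInertia (QuadRankInertia.N₁ B C M D)
              (QuadRankInertia.N₁_isHermitian B C hM hD) : ℤ)
            - ((QuadRankInertia.N₂ B C M).rank : ℤ))))) ∧
    -- maximal partial inertias
    IsGreatest
      (Set.range fun X : Matrix (Fin n) (Fin p) ℂ =>
        QuadRankInertia.posInertia (QuadRankInertia.phi B C M D X)
          (QuadRankInertia.phi_isHermitian B C hM hD X))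
      (min n (QuadRankInertia.posInertia (QuadRankInertia.N₁ B C M D)
        (QuadRankInertia.N₁_isHermitian B C hM hD))) ∧
    IsGreatest
      (Set.range fun X : Matrix (Fin n) (Fin p) ℂ =>
        QuadRankInertia.negInertia (QuadRankInertia.phi B C M D X)
          (QuadRankInertia.phi_isHermitian B C hM hD X))
      (min n (QuadRankInertia.negInertia (QuadRankInertia.N₁ B C M D)
        (QuadRankInertia.N₁_isHermitian B C hM hD))) ∧
    -- minimal partial inertias
    IsLeast
      (Set.range fun X : Matrix (Fin n) (Fin p) ℂ =>
        (QuadRankInertia.posInertia (QuadRankInertia.phi B C M D X)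
          (QuadRankInertia.phi_isHermitian B C hM hD X) : ℤ))
      (max 0
        ((QuadRankInertia.posInertia (QuadRankInertia.N₁ B C M D)
            (QuadRankInertia.N₁_isHermitian B C hM hD) : ℤ)
          - ((QuadRankInertia.N₂ B C M).rank : ℤ))) ∧
    IsLeast
      (Set.range fun X : Matrix (Fin n) (Fin p) ℂ =>
        (QuadRankInertia.negInertia (QuadRankInertia.phi B C M D X)
          (QuadRankInertia.phi_isHermitian B C hM hD X) : ℤ))
      (max 0
        ((QuadRankInertia.negInertia (QuadRankInertia.N₁ B C M D)
            (QuadRankInertia.N₁_isHermitian B C hM hD) : ℤ)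
          - ((QuadRankInertia.N₂ B C M).rank : ℤ))) := by
  obtain ⟨A, hA_def⟩ : ∃ A, A = D + C * M * Cᴴ := ⟨_, rfl⟩
  obtain ⟨G, hG_def⟩ : ∃ G, G = C * M * Bᴴ := ⟨_, rfl⟩
  obtain ⟨E, hE_def⟩ : ∃ E, E = B * M * Bᴴ := ⟨_, rfl⟩
  have hA : A.IsHermitian := hA_def ▸ hD.add (Matrix.isHermitian_mul_mul_conjTranspose _ hM)
  have hE : E.IsHermitian := hE_def ▸ Matrix.isHermitian_mul_mul_conjTranspose _ hM
  have hGc : Gᴴ = B * M * Cᴴ := by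
    rw [hG_def]
    simp only [Matrix.conjTranspose_mul, Matrix.conjTranspose_conjTranspose, hM.eq,
      Matrix.mul_assoc]
  have hphi : QuadRankInertia.phi B C M D = QuadRankInertia.quad A G E := by
    funext X
    rw [QuadRankInertia.phi_eq_quad B C D hM, hA_def, hG_def, hE_def]
  have hN1 : QuadRankInertia.N₁ B C M D = Matrix.fromBlocks A G Gᴴ E := by
    rw [hGc, hA_def, hG_def, hE_def]; rfl
  have hN2 : QuadRankInertia.N₂ B C M = Matrix.fromCols E Gᴴ := by
    rw [hGc, hE_def]; rfl
  have hN := QuadRankInertia.N₁_isHermitian B C hM hD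
  have hφ := fun X => QuadRankInertia.phi_isHermitian B C hM hD X
  revert hN hφ
  simp only [hphi, hN1, hN2]
  intro hN hφ
  have hcn := Fintype.card_fin n
  obtain ⟨X₀, hp₀, hn₀⟩ := QuadRankInertia.exists_quad_inertia_le_sub hA hE G hN
  have hr := fun X => QuadRankInertia.rank_eq_posInertia_add_negInertia (hφ X)
  have hrN := QuadRankInertia.rank_eq_posInertia_add_negInertia hN
  have lp := QuadRankInertia.posInertia_fromBlocks_le hA hE hN
  have ln := QuadRankInertia.negInertia_fromBlocks_le hA hE hN
  have up := QuadRankInertia.posInertia_quad_le hA hE hN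
  have un := QuadRankInertia.negInertia_quad_le hA hE hN
  have cp := fun X => QuadRankInertia.posInertia_le_card (hφ X)
  have cn := fun X => QuadRankInertia.negInertia_le_card (hφ X)
  have hle : ∀ X, (QuadRankInertia.quad A G E X).rank ≤ n := fun X => by
    simpa using Matrix.rank_le_card_height (QuadRankInertia.quad A G E X)
  have hleN := QuadRankInertia.rank_quad_le A G E
  rw [hcn] at cp cn
  have lp₀ := lp X₀
  have ln₀ := ln X₀
  have hr₀ := hr X₀
  refine ⟨⟨?_, ?_⟩, ⟨⟨X₀, ?_⟩, ?_⟩, ⟨?_, ?_⟩, ⟨?_, ?_⟩, ⟨⟨X₀, ?_⟩, ?_⟩, ⟨⟨X₀, ?_⟩, ?_⟩⟩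
  · obtain ⟨X, h⟩ := QuadRankInertia.exists_min_le_rank_quad hN
    rw [hcn] at h
    exact ⟨X, le_antisymm (le_min (hle X) (hleN X)) h⟩
  · rintro _ ⟨X, rfl⟩
    exact le_min (hle X) (hleN X)
  -- With a, b = i±(N₁) - r(N₂), the rank at X₀ is max(0, a) + max(0, b) = max(0, a + b, a, b), and
  -- a + b = r(N₁) - 2r(N₂).
  · dsimp only
    omega
  · rintro _ ⟨X, rfl⟩
    have := lp X
    have := ln X
    have := hr X
    dsimp only
    omega
  · obtain ⟨X, h⟩ := QuadRankInertia.exists_min_le_posInertia_quad hA hE hN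
    rw [hcn] at h
    exact ⟨X, le_antisymm (le_min (cp X) (up X)) h⟩
  · rintro _ ⟨X, rfl⟩
    exact le_min (cp X) (up X)
  · obtain ⟨X, h⟩ := QuadRankInertia.exists_min_le_negInertia_quad hA hE hN
    rw [hcn] at h
    exact ⟨X, le_antisymm (le_min (cn X) (un X)) h⟩
  · rintro _ ⟨X, rfl⟩
    exact le_min (cn X) (un X)
  · dsimp only
    omega
  · rintro _ ⟨X, rfl⟩
    have := lp X
    dsimp only
    omega
  · dsimp only
    omega
  · rintro _ ⟨X, rfl⟩
    have := ln X
    dsimp only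
    omega
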